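/- Let $d\ge 1$. A complex Hadamard matrix of order $d$ is a $d\times d$ complex matrix $H$ whose entries all have modulus $1$ and whose rows are pairwise orthogonal, i.e. $HH^*=dI$. Complex Hadamard matrices $H_1,\dots,H_m$ of order $d$ are called mutually unbiased (MUHs) if $\frac{1}{\sqrt d}H_j^*H_k$ is a complex Hadamard matrix for all $1\le j\ne k\le m$; the system is complete if $m=d$. It is normalized if all coordinates of the first column of $H_1$ are $1$ and every column of every $H_j$ has first coordinate $1$. Let $H_1,\dots,H_d$ be a normalized complete system of MUHs of order $d$. If $d\in\{3,4,5\}$, then every entry $z$ of every matrix $H_j$ satisfies $z^d=1$. If $d=2$, then every entry $z$ of every matrix $H_j$ satisfies $z^4=1$. -/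

import Mathlib

open scoped Matrix

/-- A complex Hadamard matrix of order `d`: all entries have modulus `1` and the rows are pairwise
orthogonal. Since the matrix is square and each row has squared norm `d`, this is the equation
`H * Hᴴ = d • 1`, which also gives orthogonality of the columns. -/
structure IsComplexHadamard {d : ℕ} (H : Matrix (Fin d) (Fin d) ℂ) : Prop where
  norm_entry : ∀ r k, ‖H r k‖ = 1
  mul_conjTranspose : H * Hᴴ = (d : ℂ) • (1 : Matrix (Fin d) (Fin d) ℂ)

/-- A system of `m` mutually unbiased complex Hadamard matrices (MUHs) of order `d`: each `H j` is
complex Hadamard, and for `j ≠ k` the matrix `(1 / √d) (H j)ᴴ (H k)` is complex Hadamard too.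
The system is complete when `m = d`. -/
structure IsMUHSystem {m d : ℕ} (H : Fin m → Matrix (Fin d) (Fin d) ℂ) : Prop where
  hadamard : ∀ j, IsComplexHadamard (H j)
  unbiased : ∀ j k, j ≠ k →
    IsComplexHadamard (((1 / Real.sqrt (d : ℝ) : ℝ) : ℂ) • ((H j)ᴴ * H k))

/-- A system of matrices is normalized when the first column of the first matrix has all
coordinates `1`, and every column of every matrix has first coordinate `1`. -/
structure IsNormalizedSystem {m d : ℕ} [NeZero m] [NeZero d]
    (H : Fin m → Matrix (Fin d) (Fin d) ℂ) : Prop where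
  first_column : ∀ r, H 0 r 0 = 1
  first_row : ∀ j k, H j 0 k = 1

/-! ### Certificates for a linear program on exponent vectors -/

/-! Let u run over all d² columns of the system. For an exponent vector γ, let F(γ) be the squared
modulus of the sum of all monomials u^γ (`totalEnergy`), and G(γ) the sum over the matrices of the
squared moduli of their partial sums (`matrixEnergy`). Weighting the projections u u* by u^γ and
computing the Frobenius norm in two ways gives, because the inner products of columns have known
moduli, Σ F(γ + e_r - e_t) = d F(γ) - d G(γ) + d⁴ and Σ G(γ + e_r - e_t) = d⁴. Also 0 ≤ F ≤ d G,
F(0) = d⁴ and G(0) = d³. These linear relations alone force F(p(e_r - e_0)) to attain its maximum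
d⁴, with p = d for d = 3, 4, 5 and p = 4 for d = 2. An explicit dual solution of the linear program,
checked in integers, shows it (`Certifies.le`). Equality in the triangle inequality then makes all
p-th powers in row r equal, and normalization makes them 1.

Symmetrizing F and G under permutations and negation of γ leaves one unknown per orbit, which keeps
the certificates finite and small. -/

/-- A formal integer combination of exponent vectors. -/
abbrev ExponentForm := List (List ℤ × ℤ)

namespace ExponentForm

/-- The value of a formal combination under a real-valued function on exponent vectors. -/
noncomputable def eval (F : List ℤ → ℝ) (L : ExponentForm) : ℝ :=
  (L.map fun p => (p.2 : ℝ) * F p.1).sum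

/-- Add a multiple of one exponent vector, collecting like terms. -/
def addTerm (k : List ℤ) (a : ℤ) : ExponentForm → ExponentForm
  | [] => [(k, a)]
  | p :: L => if p.1 = k then (p.1, p.2 + a) :: L else p :: addTerm k a L

/-- Add the same multiple of each exponent vector of a list. -/
def addTerms (ks : List (List ℤ)) (a : ℤ) (L : ExponentForm) : ExponentForm :=
  ks.foldr (fun k M => addTerm k a M) L

/-- The total coefficient of one exponent vector. -/
def coeff (k : List ℤ) : ExponentForm → ℤ
  | [] => 0
  | p :: L => (if p.1 = k then p.2 else 0) + coeff k L

/-- All coefficients are nonnegative, except possibly those of one exponent vector. -/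
def NonnegOff (k : List ℤ) (L : ExponentForm) : Prop := ∀ p ∈ L, p.1 = k ∨ 0 ≤ p.2

instance (k : List ℤ) (L : ExponentForm) : Decidable (NonnegOff k L) :=
  inferInstanceAs (Decidable (∀ p ∈ L, p.1 = k ∨ 0 ≤ p.2))

variable (F : List ℤ → ℝ)

@[simp] lemma eval_nil : eval F [] = 0 := rfl

@[simp] lemma eval_cons (p : List ℤ × ℤ) (L : ExponentForm) :
    eval F (p :: L) = p.2 * F p.1 + eval F L := by simp [eval]

@[simp] lemma eval_addTerm (k : List ℤ) (a : ℤ) (L : ExponentForm) :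
    eval F (addTerm k a L) = a * F k + eval F L := by
  induction L with
  | nil => simp [addTerm]
  | cons p L ih =>
    unfold addTerm
    split_ifs with h
    · subst h
      simp only [eval_cons]
      push_cast
      ring
    · simp only [eval_cons, ih]
      ring

@[simp] lemma eval_addTerms (ks : List (List ℤ)) (a : ℤ) (L : ExponentForm) :
    eval F (addTerms ks a L) = a * (ks.map F).sum + eval F L := by
  induction ks with
  | nil => simp [addTerms]
  | cons k ks ih =>
    have : addTerms (k :: ks) a L = addTerm k a (addTerms ks a L) := rfl
    rw [this, eval_addTerm, ih]
    simp
    ring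

/-- Terms with nonnegative coefficient can be dropped. The exempt vector `k` will be 0, where the
value of the function is known exactly, so its coefficient may have any sign. -/
lemma coeff_mul_le_eval (hF : ∀ l, 0 ≤ F l) {k : List ℤ} {L : ExponentForm}
    (hL : NonnegOff k L) : (coeff k L : ℝ) * F k ≤ eval F L := by
  induction L with
  | nil => simp [coeff]
  | cons p L ih =>
    have h1 := ih fun q hq => hL q (List.mem_cons_of_mem _ hq)
    have h2 := hL p List.mem_cons_self
    rw [eval_cons]
    unfold coeff
    split_ifs with h
    · push_cast
      rw [← h] at h1 ⊢
      linarith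
    · have h3 : (0 : ℝ) ≤ p.2 * F p.1 :=
        mul_nonneg (by exact_mod_cast h2.resolve_left h) (hF _)
      push_cast
      linarith

end ExponentForm

/-- Lexicographic comparison of integer lists. -/
def lexLE : List ℤ → List ℤ → Bool
  | [], _ => true
  | _ :: _, [] => false
  | a :: l, b :: m => if a = b then lexLE l m else decide (a ≤ b)

/-- A representative of the orbit of an exponent vector under permutations and negation. -/
def orbitRep (l : List ℤ) : List ℤ :=
  let a := l.insertionSort (· ≥ ·)
  let b := (a.map Neg.neg).reverse
  if lexLE a b then b else a

/-- Representatives of the exponent vectors `γ + e_r - e_t`, with multiplicity. -/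
def exponentNeighbours (d : ℕ) (l : List ℤ) : List (List ℤ) :=
  (List.finRange d).flatMap fun r => (List.finRange d).map fun t =>
    orbitRep (List.ofFn fun i : Fin d =>
      l.getD i 0 + (if i = r then 1 else 0) - (if i = t then 1 else 0))

/-- Multipliers attached to an exponent vector `γ`: one for each of the two neighbour identities at
`γ`, and one for the inequality between the two functions at `γ`. -/
structure ExponentMultiplier where
  /-- the exponent vector -/
  vec : List ℤ
  /-- multiplier of the identity for the first function -/
  fst : ℤ
  /-- multiplier of the identity for the second function -/
  snd : ℤ
  /-- multiplier of the inequality between the two functions -/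
  ineq : ℕ

namespace ExponentMultiplier

open ExponentForm

/-- The contribution of a list of multipliers to the coefficients of the first function. -/
def fstForm (d : ℕ) (c : List ExponentMultiplier) : ExponentForm :=
  c.foldr (fun e L => addTerms (exponentNeighbours d e.vec) (-e.fst)
    (addTerm e.vec (d * e.fst + e.ineq) L)) []

/-- The contribution of a list of multipliers to the coefficients of the second function. -/
def sndForm (d : ℕ) (c : List ExponentMultiplier) : ExponentForm :=
  c.foldr (fun e L => addTerms (exponentNeighbours d e.vec) (-e.snd)
    (addTerm e.vec (-(d * (e.fst + e.ineq))) L)) []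

/-- The list of multipliers `c` proves that the first function is as large at `t` as at `0`. -/
def Certifies (d : ℕ) (t : List ℤ) (K : ℕ) (c : List ExponentMultiplier) : Prop :=
  0 < K ∧ NonnegOff (List.replicate d 0) (addTerm t K (fstForm d c)) ∧
    NonnegOff (List.replicate d 0) (sndForm d c) ∧
    (d * K : ℤ) ≤ d * coeff (List.replicate d 0) (addTerm t K (fstForm d c)) +
      coeff (List.replicate d 0) (sndForm d c) + d * (c.map fun e => e.fst + e.snd).sum

instance (d : ℕ) (t : List ℤ) (K : ℕ) (c : List ExponentMultiplier) :
    Decidable (Certifies d t K c) := by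
  unfold Certifies
  infer_instance

/-- Weak duality: the identities enter with multipliers of either sign, and only F ≤ d G, with its
multiplier in ℕ, costs an inequality. -/
lemma eval_forms_le {d : ℕ} {F G : List ℤ → ℝ} {C : ℝ}
    (hFG : ∀ l, F l ≤ d * G l)
    (hF : ∀ l, ((exponentNeighbours d l).map F).sum = d * F l - d * G l + C)
    (hG : ∀ l, ((exponentNeighbours d l).map G).sum = C) (c : List ExponentMultiplier) :
    eval F (fstForm d c) + eval G (sndForm d c) ≤
      -(((c.map fun e => e.fst + e.snd).sum : ℤ) : ℝ) * C := by
  induction c with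
  | nil => simp [fstForm, sndForm]
  | cons e c ih =>
    have h1 : fstForm d (e :: c) = addTerms (exponentNeighbours d e.vec) (-e.fst)
      (addTerm e.vec (d * e.fst + e.ineq) (fstForm d c)) := rfl
    have h2 : sndForm d (e :: c) = addTerms (exponentNeighbours d e.vec) (-e.snd)
      (addTerm e.vec (-(d * (e.fst + e.ineq))) (sndForm d c)) := rfl
    rw [h1, h2]
    simp only [eval_addTerms, eval_addTerm, hF, hG, List.map_cons, List.sum_cons]
    push_cast at ih ⊢
    have h3 : (0 : ℝ) ≤ e.ineq * (d * G e.vec - F e.vec) :=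
      mul_nonneg (by positivity) (by linarith [hFG e.vec])
    nlinarith

theorem Certifies.le {d : ℕ} (hd : 0 < d) {t : List ℤ} {K : ℕ} {c : List ExponentMultiplier}
    (hc : Certifies d t K c) {F G : List ℤ → ℝ} {C : ℝ}
    (hF0 : ∀ l, 0 ≤ F l) (hG0 : ∀ l, 0 ≤ G l) (hFG : ∀ l, F l ≤ d * G l)
    (hF : ∀ l, ((exponentNeighbours d l).map F).sum = d * F l - d * G l + C)
    (hG : ∀ l, ((exponentNeighbours d l).map G).sum = C)
    (hFz : F (List.replicate d 0) = C) (hGz : d * G (List.replicate d 0) = C) : C ≤ F t := by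
  obtain ⟨hK, hP, hQ, hsum⟩ := hc
  have h1 := eval_forms_le hFG hF hG c
  have h2 := coeff_mul_le_eval F hF0 hP
  have h3 := coeff_mul_le_eval G hG0 hQ
  rw [eval_addTerm, hFz] at h2
  have hC : 0 ≤ C := hFz ▸ hF0 _
  have hd' : (0 : ℝ) < d := by exact_mod_cast hd
  have hK' : (0 : ℝ) < K := by exact_mod_cast hK
  have h4 := mul_le_mul_of_nonneg_right (Int.cast_le (R := ℝ).2 hsum) hC
  have h5 : (d * K : ℝ) * C ≤ (d * K) * F t := by
    -- Everything is scaled by `d` since G(0) = C / d; this keeps the certificate integral.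
    have h6 := mul_le_mul_of_nonneg_left h2 hd'.le
    have h7 := mul_le_mul_of_nonneg_left h3 hd'.le
    have h8 := mul_le_mul_of_nonneg_left h1 hd'.le
    push_cast at h4 h6 h7 h8 ⊢
    rw [mul_left_comm, hGz] at h7
    linarith
  exact le_of_mul_le_mul_left h5 (by positivity)

end ExponentMultiplier

/-- The certificate in order two. -/
def multipliersOrderTwo : List ExponentMultiplier :=
  [⟨[1, -1], -2, 2, 0⟩,
   ⟨[3, -3], 2, -2, 0⟩,
   ⟨[4, -4], 0, 0, 1⟩]

/-- The exponent 4 cannot be lowered to 2: the system with second rows (1, -1) and (i, -i) is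
complete. -/
lemma certifies_order_two :
    ExponentMultiplier.Certifies 2 [4, -4] 1 multipliersOrderTwo := by
  decide +kernel

/-- The certificate in order three. -/
def multipliersOrderThree : List ExponentMultiplier :=
  [⟨[1, 0, -1], -11, 9, 0⟩,
   ⟨[2, -1, -1], 0, -6, 0⟩,
   ⟨[2, 0, -2], 1, 0, 0⟩,
   ⟨[3, -1, -2], 0, 0, 4⟩]

lemma certifies_order_three :
    ExponentMultiplier.Certifies 3 [3, 0, -3] 1 multipliersOrderThree := by
  decide +kernel

/-- The certificate in order four. -/
def multipliersOrderFour : List ExponentMultiplier :=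
  [⟨[1, 0, 0, -1], -149, 120, 0⟩,
   ⟨[1, 1, -1, -1], 20, -70, 0⟩,
   ⟨[2, 0, -1, -1], 14, -40, 0⟩,
   ⟨[2, 0, 0, -2], -6, -4, 0⟩,
   ⟨[2, 1, -1, -2], 0, 0, 92⟩,
   ⟨[3, -1, -1, -1], 0, 0, 10⟩,
   ⟨[3, 0, -1, -2], -4, 0, 0⟩,
   ⟨[3, 0, 0, -3], 1, 0, 0⟩]

lemma certifies_order_four :
    ExponentMultiplier.Certifies 4 [4, 0, 0, -4] 1 multipliersOrderFour := by
  decide +kernel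

/-- The certificate in order five. -/
def multipliersOrderFive : List ExponentMultiplier :=
  [⟨[1, 0, 0, 0, -1], -162064483299852452, 112789771495412600, 0⟩,
   ⟨[1, 1, 0, -1, -1], 8240801457489609, -75985894699180065, 0⟩,
   ⟨[2, 0, 0, -1, -1], 2485502810405328, -66749876214094260, 0⟩,
   ⟨[2, 0, 0, 0, -2], -7442200754486950, 7078261274632440, 0⟩,
   ⟨[2, 1, -1, -1, -1], 392766282082662, 22869368958956970, 46768240035608586⟩,
   ⟨[2, 1, 0, -1, -2], 34002360164965572, 30822061584014550, 0⟩,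
   ⟨[3, 0, -1, -1, -1], 1271499980101164, 17032302419445930, 0⟩,
   ⟨[3, 0, 0, -1, -2], 1405407721245858, -8292383251966080, 0⟩,
   ⟨[2, 2, -1, -1, -2], -21670952600227158, 0, 0⟩,
   ⟨[2, 2, 0, -2, -2], -3439442623608990, -3343008773641140, 0⟩,
   ⟨[3, 1, -1, -1, -2], -17493052806821160, -14254339704764310, 0⟩,
   ⟨[3, 1, 0, -2, -2], -2000589915260556, 0, 0⟩,
   ⟨[3, 1, 0, -1, -3], 0, 2312428178627370, 0⟩,
   ⟨[4, -1, -1, -1, -1], 1099173195216195, -6121782325951545, 0⟩,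
   ⟨[4, 0, -1, -1, -2], -771935871432060, 6896777654773620, 0⟩,
   ⟨[4, 0, 0, -2, -2], 279144468273798, -1153575775395540, 0⟩,
   ⟨[4, 0, 0, -1, -3], -194876217684702, -1098306201293730, 0⟩,
   ⟨[4, 0, 0, 0, -4], 107787528446511, 0, 0⟩,
   ⟨[3, 2, -1, -2, -2], 3148548815721024, 3090195402236100, 0⟩,
   ⟨[3, 2, -1, -1, -3], 1113201609350814, -451483048907550, 0⟩,
   ⟨[3, 2, 0, -2, -3], 1156436441856018, 0, 0⟩,
   ⟨[4, 1, -1, -2, -2], -58753641858696, 2319373305414360, 0⟩,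
   ⟨[4, 1, -1, -1, -3], 0, 591982789728600, 0⟩,
   ⟨[4, 1, 0, -2, -3], -559021117382676, 0, 0⟩,
   ⟨[4, 1, 0, -1, -4], -259956271099422, 0, 0⟩,
   ⟨[5, -1, -1, -1, -2], -499564108669104, 1183965579457200, 3519178173100968⟩,
   ⟨[5, 0, -1, -2, -2], 827388369579384, -3193730259527880, 0⟩,
   ⟨[5, 0, -1, -1, -3], 0, -591982789728600, 0⟩,
   ⟨[5, 0, 0, -2, -3], 402136009342524, 843647633434800, 780863600655270⟩,
   ⟨[3, 3, -2, -2, -2], -1033034450618940, -270979437585360, 414995370171720⟩,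
   ⟨[3, 3, -1, -2, -3], -1543247928985068, 812938312756080, 0⟩,
   ⟨[3, 3, 0, -3, -3], -162587662551216, 0, 0⟩,
   ⟨[4, 1, 1, -3, -3], -72291052769706, 0, 0⟩,
   ⟨[4, 2, -2, -2, -2], -1190305516564236, 541958875170720, 0⟩,
   ⟨[4, 2, -1, -2, -3], -919326078978876, -1625876625512160, 0⟩,
   ⟨[4, 2, -1, -1, -4], 297075376938222, 0, 0⟩,
   ⟨[4, 2, 0, -3, -3], 162587662551216, 0, 0⟩,
   ⟨[4, 2, 0, -2, -4], 325175325102432, 0, 0⟩,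
   ⟨[5, 1, -2, -2, -2], -104400193645572, 0, 0⟩,
   ⟨[5, 1, -1, -2, -3], 337459053373920, 0, 0⟩,
   ⟨[5, 1, 0, -3, -3], -337459053373920, 0, 0⟩,
   ⟨[5, 1, 0, -2, -4], -337459053373920, 0, 0⟩,
   ⟨[6, -1, -1, -2, -2], -71633295768744, 0, 0⟩,
   ⟨[6, -1, -1, -1, -3], -118396557945720, 0, 0⟩,
   ⟨[6, 0, -2, -2, -2], -41641469973228, 0, 680387521878804⟩,
   ⟨[6, 0, -1, -2, -3], 100665937482480, 0, 1076160228846192⟩,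
   ⟨[6, 0, -1, -1, -4], 118396557945720, 0, 0⟩,
   ⟨[6, 0, 0, -3, -3], -168729526686960, 0, 0⟩,
   ⟨[6, 0, 0, -2, -4], -168729526686960, 0, 0⟩,
   ⟨[6, 0, 0, -1, -5], -64676955968604, 0, 0⟩,
   ⟨[5, 2, -1, -2, -4], 0, 0, 325175325102432⟩]

/-- The factor `K` scales the target, so that a rational dual solution can be written with integers.
-/
lemma certifies_order_five :
    ExponentMultiplier.Certifies 5 [5, 0, 0, 0, -5] 43110572477907 multipliersOrderFive := by
  decide +kernel

/-! ### Symmetrised functions of exponent vectors -/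

/-- The sum of a function over all rearrangements of an exponent vector. -/
noncomputable def symSum {d : ℕ} (f : (Fin d → ℤ) → ℝ) (l : List ℤ) : ℝ :=
  ∑ σ : Equiv.Perm (Fin d), f fun i => l.getD (σ i) 0

lemma ofFn_getD {d : ℕ} {l : List ℤ} (hl : l.length = d) :
    List.ofFn (fun i : Fin d => l.getD i 0) = l := by
  subst hl
  apply List.ext_getElem <;> simp

lemma getD_ofFn {d : ℕ} (g : Fin d → ℤ) (i : Fin d) : (List.ofFn g).getD i 0 = g i := by
  simp [List.getD_eq_getElem?_getD]

/-- Both functions take each value equally often, so bijections between their fibres glue to a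
permutation. -/
lemma exists_perm_comp_of_ofFn_perm {d : ℕ} {g h : Fin d → ℤ}
    (hp : (List.ofFn g).Perm (List.ofFn h)) : ∃ σ : Equiv.Perm (Fin d), ∀ i, g i = h (σ i) := by
  have hcard : ∀ a, Fintype.card {i // g i = a} = Fintype.card {i // h i = a} := by
    intro a
    have key : ∀ g : Fin d → ℤ, (List.ofFn g).count a = Fintype.card {i // g i = a} := by
      intro g
      rw [List.ofFn_eq_map, List.count, List.countP_map, List.countP_eq_length_filter,
        Fintype.card_subtype, Finset.card_def, Finset.filter_val, Fin.univ_def]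
      simp only [Multiset.filter_coe, Multiset.coe_card]
      rfl
    rw [← key, ← key, hp.count_eq]
  let e : ∀ a, {i // g i = a} ≃ {i // h i = a} := fun a => Fintype.equivOfCardEq (hcard a)
  refine ⟨Equiv.ofFiberEquiv e, fun i => (Equiv.ofFiberEquiv_map e i).symm⟩

lemma symSum_perm {d : ℕ} (f : (Fin d → ℤ) → ℝ) {l m : List ℤ} (hl : l.length = d)
    (h : l.Perm m) : symSum f l = symSum f m := by
  have hm : m.length = d := h.length_eq ▸ hl
  rw [← ofFn_getD hl, ← ofFn_getD hm] at h
  obtain ⟨τ, hτ⟩ := exists_perm_comp_of_ofFn_perm h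
  unfold symSum
  simp only [hτ]
  exact Equiv.sum_comp (Equiv.mulLeft τ) fun σ : Equiv.Perm (Fin d) =>
    f fun i => m.getD (σ i) 0

lemma symSum_map_neg {d : ℕ} {f : (Fin d → ℤ) → ℝ} (hf : ∀ γ, f (-γ) = f γ) (l : List ℤ) :
    symSum f (l.map Neg.neg) = symSum f l := by
  unfold symSum
  refine Finset.sum_congr rfl fun σ _ => ?_
  rw [← hf]
  congr 1
  ext i
  simp only [Pi.neg_apply, List.getD_eq_getElem?_getD, List.getElem?_map]
  cases l[(σ i : ℕ)]? <;> simp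

lemma symSum_orbitRep {d : ℕ} {f : (Fin d → ℤ) → ℝ} (hf : ∀ γ, f (-γ) = f γ) {l : List ℤ}
    (hl : l.length = d) : symSum f (orbitRep l) = symSum f l := by
  have h1 : (l.insertionSort (· ≥ ·)).Perm l := List.perm_insertionSort _ _
  have h2 : symSum f (l.insertionSort (· ≥ ·)) = symSum f l :=
    symSum_perm f (h1.length_eq.trans hl) h1
  unfold orbitRep
  dsimp only
  split_ifs
  · rw [symSum_perm f (by simp [hl]) (List.reverse_perm _), symSum_map_neg hf, h2]
  · exact h2

/-- The neighbour `γ + e_r - e_t` of an exponent vector. -/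
def shiftExponent {d : ℕ} (γ : Fin d → ℤ) (r t : Fin d) : Fin d → ℤ :=
  fun i => γ i + (if i = r then 1 else 0) - (if i = t then 1 else 0)

/-- A permutation of coordinates only relabels the pairs (r, t). The default 0 in `getD` makes this
hold for lists of every length, so the identities can be assumed for all lists in `Certifies.le`. -/
lemma sum_exponentNeighbours {d : ℕ} {f : (Fin d → ℤ) → ℝ} (hf : ∀ γ, f (-γ) = f γ)
    (l : List ℤ) : ((exponentNeighbours d l).map (symSum f)).sum =
      symSum (fun γ => ∑ r, ∑ t, f (shiftExponent γ r t)) l := by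
  have h1 : ((exponentNeighbours d l).map (symSum f)).sum = ∑ r : Fin d, ∑ t : Fin d,
      symSum f (List.ofFn (shiftExponent (fun i => l.getD i 0) r t)) := by
    have h2 : ∀ r t : Fin d,
        symSum f (orbitRep (List.ofFn (shiftExponent (fun i => l.getD i 0) r t))) =
        symSum f (List.ofFn (shiftExponent (fun i => l.getD i 0) r t)) := fun r t =>
      symSum_orbitRep hf (by simp)
    unfold exponentNeighbours
    simp only [Fin.sum_univ_def, ← h2, List.map_flatMap, List.map_map]
    rw [List.flatMap_def, List.sum_flatten, List.map_map]
    rfl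
  rw [h1]
  simp only [symSum, getD_ofFn]
  rw [Finset.sum_congr rfl fun r _ => Finset.sum_comm, Finset.sum_comm]
  refine Finset.sum_congr rfl fun σ _ => ?_
  rw [← Equiv.sum_comp σ]
  refine Finset.sum_congr rfl fun r _ => ?_
  rw [← Equiv.sum_comp σ]
  refine Finset.sum_congr rfl fun t _ => ?_
  congr 1
  ext i
  simp [shiftExponent]

/-! ### Character sums over the columns of a system of unbiased Hadamard matrices -/

open ComplexConjugate

/-- Both sides are the squared Frobenius norm of Σ c_x u_x u_x*, by entries and by inner products.
-/
lemma sum_norm_sq_sum_mul_conj {X : Type*} [Fintype X] {d : ℕ} (c : X → ℂ) (u : X → Fin d → ℂ) :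
    ((∑ r, ∑ t, ‖∑ x, c x * u x r * conj (u x t)‖ ^ 2 : ℝ) : ℂ) =
      ∑ x, ∑ y, c x * conj (c y) * ((‖∑ r, u x r * conj (u y r)‖ ^ 2 : ℝ) : ℂ) := by
  push_cast
  simp only [← Complex.mul_conj', map_sum, map_mul, Complex.conj_conj, Finset.sum_mul_sum]
  simp only [Finset.mul_sum]
  rw [Finset.sum_congr rfl fun r _ => Finset.sum_comm, Finset.sum_comm]
  refine Finset.sum_congr rfl fun x _ => ?_
  rw [Finset.sum_congr rfl fun r _ => Finset.sum_comm, Finset.sum_comm]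
  refine Finset.sum_congr rfl fun y _ => ?_
  refine Finset.sum_congr rfl fun r _ => Finset.sum_congr rfl fun t _ => ?_
  ring

namespace IsComplexHadamard

variable {d : ℕ} {H : Matrix (Fin d) (Fin d) ℂ}

lemma conjTranspose_mul (hH : IsComplexHadamard H) (hd : d ≠ 0) :
    Hᴴ * H = (d : ℂ) • (1 : Matrix (Fin d) (Fin d) ℂ) := by
  have hd' : (d : ℂ) ≠ 0 := by exact_mod_cast hd
  have h1 : H * ((d : ℂ)⁻¹ • Hᴴ) = 1 := by
    rw [Matrix.mul_smul, hH.mul_conjTranspose, smul_smul, inv_mul_cancel₀ hd', one_smul]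
  have h2 := mul_eq_one_comm.1 h1
  rw [Matrix.smul_mul] at h2
  rw [← h2, smul_smul, mul_inv_cancel₀ hd', one_smul]

lemma norm_sq_inner_columns (hH : IsComplexHadamard H) (hd : d ≠ 0) (k l : Fin d) :
    ‖∑ r, H r k * conj (H r l)‖ ^ 2 = if k = l then (d : ℝ) ^ 2 else 0 := by
  have h := congrFun (congrFun (hH.conjTranspose_mul hd) l) k
  have h2 : ∑ r, H r k * conj (H r l) = (Hᴴ * H) l k := by
    simp [Matrix.mul_apply, mul_comm]
  rw [h2, h]
  by_cases hkl : k = l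
  · subst hkl
    simp
  · simp [hkl, Ne.symm hkl]

end IsComplexHadamard

lemma IsMUHSystem.norm_sq_inner_columns {m d : ℕ} {H : Fin m → Matrix (Fin d) (Fin d) ℂ}
    (hH : IsMUHSystem H) (hd : d ≠ 0) {i j : Fin m} (hij : i ≠ j) (k l : Fin d) :
    ‖∑ r, H i r k * conj (H j r l)‖ ^ 2 = d := by
  have h := (hH.unbiased j i hij.symm).norm_entry l k
  have h2 : ∑ r, H i r k * conj (H j r l) = ((H j)ᴴ * H i) l k := by
    simp [Matrix.mul_apply, mul_comm]
  have hpos : 0 < Real.sqrt d := Real.sqrt_pos.2 (by positivity)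
  rw [Matrix.smul_apply, smul_eq_mul, norm_mul, Complex.norm_real, Real.norm_eq_abs,
    abs_of_pos (by positivity), one_div, inv_mul_eq_one₀ hpos.ne'] at h
  rw [h2, ← h, Real.sq_sqrt (by positivity)]

/-- The Laurent monomial with exponent vector `γ`. -/
noncomputable def laurentMonomial {d : ℕ} (v : Fin d → ℂ) (γ : Fin d → ℤ) : ℂ :=
  ∏ r, v r ^ γ r

section laurentMonomial

variable {d : ℕ} {v : Fin d → ℂ}

lemma norm_laurentMonomial (hv : ∀ r, ‖v r‖ = 1) (γ : Fin d → ℤ) :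
    ‖laurentMonomial v γ‖ = 1 := by
  simp [laurentMonomial, norm_prod, norm_zpow, hv]

lemma laurentMonomial_neg (hv : ∀ r, ‖v r‖ = 1) (γ : Fin d → ℤ) :
    laurentMonomial v (-γ) = conj (laurentMonomial v γ) := by
  simp only [laurentMonomial, map_prod, map_zpow₀, Pi.neg_apply, zpow_neg, ← inv_zpow]
  exact Finset.prod_congr rfl fun r _ => by rw [Complex.inv_eq_conj (hv r)]

lemma laurentMonomial_shiftExponent (hv : ∀ r, ‖v r‖ = 1) (γ : Fin d → ℤ) (r t : Fin d) :
    laurentMonomial v (shiftExponent γ r t) = laurentMonomial v γ * v r * conj (v t) := by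
  have hne : ∀ r, v r ≠ 0 := fun r h => by simpa [h] using hv r
  simp only [laurentMonomial, shiftExponent]
  simp only [fun i => zpow_sub₀ (hne i), fun i => zpow_add₀ (hne i), Finset.prod_div_distrib,
    Finset.prod_mul_distrib]
  rw [← Complex.inv_eq_conj (hv t), div_eq_mul_inv]
  congr 2
  · rw [Finset.prod_eq_single r] <;> simp +contextual
  · rw [Finset.prod_eq_single t] <;> simp +contextual

end laurentMonomial

/-! ### Energies of exponent vectors and their neighbour identities. -/

section columnSums

variable {m d : ℕ} (H : Fin m → Matrix (Fin d) (Fin d) ℂ)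

/-- The sum of a Laurent monomial over the columns of one matrix. -/
noncomputable def columnSum (γ : Fin d → ℤ) (j : Fin m) : ℂ :=
  ∑ k, laurentMonomial (fun r => H j r k) γ

/-- The squared modulus of the sum of a Laurent monomial over all columns of a system. -/
noncomputable def totalEnergy (γ : Fin d → ℤ) : ℝ := ‖∑ j, columnSum H γ j‖ ^ 2

/-- The sum over all matrices of the squared moduli of the sums of a Laurent monomial over the
columns. -/
noncomputable def matrixEnergy (γ : Fin d → ℤ) : ℝ := ∑ j, ‖columnSum H γ j‖ ^ 2

lemma totalEnergy_le (γ : Fin d → ℤ) : totalEnergy H γ ≤ m * matrixEnergy H γ := by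
  have h1 : ‖∑ j, columnSum H γ j‖ ^ 2 ≤ (∑ j, ‖columnSum H γ j‖) ^ 2 :=
    pow_le_pow_left₀ (norm_nonneg _) (norm_sum_le _ _) 2
  have h2 := sq_sum_le_card_mul_sum_sq (s := Finset.univ) (f := fun j => ‖columnSum H γ j‖)
  simp only [Finset.card_univ, Fintype.card_fin] at h2
  exact h1.trans h2

variable {H}

lemma columnSum_neg (hH : ∀ j r k, ‖H j r k‖ = 1) (γ : Fin d → ℤ) (j : Fin m) :
    columnSum H (-γ) j = conj (columnSum H γ j) := by
  simp only [columnSum, map_sum]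
  exact Finset.sum_congr rfl fun k _ => laurentMonomial_neg (fun r => hH j r k) γ

lemma totalEnergy_neg (hH : ∀ j r k, ‖H j r k‖ = 1) (γ : Fin d → ℤ) :
    totalEnergy H (-γ) = totalEnergy H γ := by
  simp only [totalEnergy, columnSum_neg hH, ← map_sum, RCLike.norm_conj]

lemma matrixEnergy_neg (hH : ∀ j r k, ‖H j r k‖ = 1) (γ : Fin d → ℤ) :
    matrixEnergy H (-γ) = matrixEnergy H γ := by
  simp only [matrixEnergy, columnSum_neg hH, RCLike.norm_conj]

/-- With c_x = u_x^γ, entry (r, t) of Σ c_x u_x u_x* is the column sum at γ + e_r - e_t. Within one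
matrix only the d diagonal pairs contribute, each d². -/
lemma sum_matrixEnergy_shiftExponent (hH : ∀ j, IsComplexHadamard (H j)) (hd : d ≠ 0)
    (γ : Fin d → ℤ) :
    ∑ r, ∑ t, matrixEnergy H (shiftExponent γ r t) = m * (d : ℝ) ^ 3 := by
  have key : ∀ j, ∑ r, ∑ t, ‖columnSum H (shiftExponent γ r t) j‖ ^ 2 = (d : ℝ) ^ 3 := by
    intro j
    have h := sum_norm_sq_sum_mul_conj
      (fun k => laurentMonomial (fun r => H j r k) γ) (fun k r => H j r k)
    simp only [(hH j).norm_sq_inner_columns hd] at h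
    simp only [columnSum, fun k => laurentMonomial_shiftExponent
      (fun r => (hH j).norm_entry r k)]
    apply Complex.ofReal_injective
    rw [h]
    simp only [apply_ite Complex.ofReal, Complex.ofReal_zero, mul_ite, mul_zero,
      Finset.sum_ite_eq, Finset.mem_univ, if_true, Complex.mul_conj',
      fun k => norm_laurentMonomial (fun r => (hH j).norm_entry r k)]
    simp
    ring
  simp only [matrixEnergy]
  rw [Finset.sum_congr rfl fun r _ => Finset.sum_comm, Finset.sum_comm]
  simp [key]

lemma sum_totalEnergy_shiftExponent (hH : IsMUHSystem H) (hd : d ≠ 0) (γ : Fin d → ℤ) :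
    ∑ r, ∑ t, totalEnergy H (shiftExponent γ r t) =
      d * totalEnergy H γ - d * matrixEnergy H γ + m * (d : ℝ) ^ 3 := by
  have hn : ∀ j k r, ‖H j r k‖ = 1 := fun j k r => (hH.hadamard j).norm_entry r k
  set c : Fin m → Fin d → ℂ := fun j k => laurentMonomial (fun r => H j r k) γ with hc
  have h := sum_norm_sq_sum_mul_conj (X := Fin m × Fin d) (fun x => c x.1 x.2)
    (fun x r => H x.1 r x.2)
  -- The constant d, present for all pairs, yields d F(γ); correcting the pairs inside one matrix
  -- yields -d G(γ), and the pairs of equal columns give the constant.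
  have hin : ∀ i j k l, ((‖∑ r, H i r k * conj (H j r l)‖ ^ 2 : ℝ) : ℂ) =
      d + ((if i = j then (if k = l then (d : ℂ) ^ 2 else 0) else 0) -
        (if i = j then (d : ℂ) else 0)) := by
    intro i j k l
    by_cases hij : i = j
    · subst hij
      rw [(hH.hadamard i).norm_sq_inner_columns hd]
      simp only [if_true]
      split_ifs <;> simp
    · rw [hH.norm_sq_inner_columns hd hij]
      simp [hij]
  simp only [Fintype.sum_prod_type, hin] at h
  simp only [totalEnergy, matrixEnergy, columnSum,
    fun j k => laurentMonomial_shiftExponent (hn j k)]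
  apply Complex.ofReal_injective
  rw [h]
  have e1 : ∀ i k, c i k * conj (c i k) = 1 := by
    intro i k
    rw [Complex.mul_conj', norm_laurentMonomial (hn i k)]
    simp
  have h1 : ∑ i, ∑ k, ∑ j, ∑ l, c i k * conj (c j l) * (d : ℂ) =
      d * ((‖∑ j, ∑ k, c j k‖ ^ 2 : ℝ) : ℂ) := by
    push_cast
    rw [← Complex.mul_conj']
    simp only [map_sum, Finset.sum_mul]
    simp only [Finset.mul_sum]
    exact Finset.sum_congr rfl fun _ _ => Finset.sum_congr rfl fun _ _ =>
      Finset.sum_congr rfl fun _ _ => Finset.sum_congr rfl fun _ _ => by ring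
  have h2 : ∑ i, ∑ k, ∑ j, ∑ l, c i k * conj (c j l) *
      (if i = j then (if k = l then (d : ℂ) ^ 2 else 0) else 0) = m * (d : ℂ) ^ 3 := by
    simp only [mul_ite, mul_zero]
    have : ∀ i k, ∑ j, ∑ l, (if i = j then (if k = l then c i k * conj (c j l) * (d : ℂ) ^ 2
        else 0) else 0) = (d : ℂ) ^ 2 := by
      intro i k
      rw [Finset.sum_eq_single i (fun j _ hj => by simp [Ne.symm hj]) (by simp)]
      simp [e1]
    simp only [this, Finset.sum_const, Finset.card_univ, Fintype.card_fin, nsmul_eq_mul]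
    ring
  have h3 : ∑ i, ∑ k, ∑ j, ∑ l, c i k * conj (c j l) * (if i = j then (d : ℂ) else 0) =
      d * ((∑ j, ‖∑ k, c j k‖ ^ 2 : ℝ) : ℂ) := by
    push_cast
    rw [Finset.mul_sum]
    refine Finset.sum_congr rfl fun i _ => ?_
    rw [← Complex.mul_conj', map_sum, Finset.sum_mul, Finset.mul_sum]
    refine Finset.sum_congr rfl fun k _ => ?_
    rw [Finset.sum_eq_single i (fun j _ hj => by simp [Ne.symm hj]) (by simp), Finset.mul_sum,
      Finset.mul_sum]
    refine Finset.sum_congr rfl fun l _ => ?_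
    rw [if_pos rfl]
    ring
  simp only [mul_add, mul_sub, Finset.sum_add_distrib, Finset.sum_sub_distrib, h1, h2, h3]
  push_cast
  ring

end columnSums

-- Equality in the triangle inequality: the numbers Re(z_x S̄) are at most |S| and average to |S|,
-- so each z_x S̄ equals |S|, and S ≠ 0 cancels.
open scoped ComplexOrder in
lemma eq_of_norm_sum_eq_card {X : Type*} [Fintype X] {z : X → ℂ} (hz : ∀ x, ‖z x‖ = 1)
    (h : ‖∑ x, z x‖ = Fintype.card X) (x y : X) : z x = z y := by
  set S := ∑ x, z x with hS
  have hle : ∀ x ∈ Finset.univ, (z x * conj S).re ≤ ‖S‖ := fun x _ => by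
    simpa [hz] using Complex.re_le_norm (z x * conj S)
  have hsum : ∑ x, (z x * conj S).re = ∑ _x : X, ‖S‖ := by
    rw [← Complex.re_sum, ← Finset.sum_mul, ← hS, Complex.mul_conj', Finset.sum_const,
      Finset.card_univ, nsmul_eq_mul, ← h, ← sq]
    exact_mod_cast Complex.ofReal_re _
  have heq := (Finset.sum_eq_sum_iff_of_le hle).1 hsum
  have hval : ∀ x, z x * conj S = ‖S‖ := by
    intro x
    have hnorm : ‖z x * conj S‖ = ‖S‖ := by simp [hz]
    have h0 : 0 ≤ z x * conj S := Complex.re_eq_norm.1 (by rw [hnorm, heq x (Finset.mem_univ x)])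
    rw [← hnorm]
    exact Complex.eq_coe_norm_of_nonneg h0
  have hne : conj S ≠ 0 := by
    have : (0 : ℝ) < Fintype.card X := by exact_mod_cast Fintype.card_pos_iff.2 ⟨x⟩
    rw [← h] at this
    simpa using this
  exact mul_right_cancel₀ hne ((hval x).trans (hval y).symm)

/-! ### Entries of a complete system -/

lemma symSum_const_mul {d : ℕ} (f g : (Fin d → ℤ) → ℝ) (a b c : ℝ) (l : List ℤ) :
    symSum (fun γ => a * f γ - b * g γ + c) l =
      a * symSum f l - b * symSum g l + (d.factorial : ℝ) * c := by
  simp [symSum, Finset.sum_add_distrib, Finset.sum_sub_distrib, Finset.mul_sum,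
    Fintype.card_perm]

lemma symSum_const {d : ℕ} (c : ℝ) (l : List ℤ) :
    symSum (fun _ : Fin d → ℤ => c) l = (d.factorial : ℝ) * c := by
  simp [symSum, Fintype.card_perm]

theorem totalEnergy_eq_of_certifies {d : ℕ} {H : Fin d → Matrix (Fin d) (Fin d) ℂ}
    (hH : IsMUHSystem H) (hd : d ≠ 0) {t : List ℤ} {K : ℕ} {c : List ExponentMultiplier}
    (hc : ExponentMultiplier.Certifies d t K c) {γ : Fin d → ℤ}
    (hγ : orbitRep (List.ofFn γ) = t) : totalEnergy H γ = (d : ℝ) ^ 4 := by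
  have hn : ∀ j r k, ‖H j r k‖ = 1 := fun j => (hH.hadamard j).norm_entry
  have hz : ∀ σ : Equiv.Perm (Fin d), (fun i => (List.replicate d (0 : ℤ)).getD (σ i) 0) = 0 := by
    intro σ
    ext i
    simp [List.getD_eq_getElem?_getD]
  have hcol : ∀ j, columnSum H 0 j = d := by simp [columnSum, laurentMonomial]
  have h := hc.le (Nat.pos_of_ne_zero hd) (F := symSum (totalEnergy H))
    (G := symSum (matrixEnergy H)) (C := d.factorial * (d : ℝ) ^ 4)
    (fun l => Finset.sum_nonneg fun σ _ => by unfold totalEnergy; positivity)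
    (fun l => Finset.sum_nonneg fun σ _ => by unfold matrixEnergy; positivity)
    (fun l => by
      unfold symSum
      rw [Finset.mul_sum]
      exact Finset.sum_le_sum fun σ _ => totalEnergy_le H _)
    (fun l => by
      rw [sum_exponentNeighbours (totalEnergy_neg hn)]
      simp only [sum_totalEnergy_shiftExponent hH hd, symSum_const_mul]
      ring)
    (fun l => by
      rw [sum_exponentNeighbours (matrixEnergy_neg hn)]
      simp only [sum_matrixEnergy_shiftExponent hH.hadamard hd, symSum_const]
      ring)
    (by
      simp only [symSum, hz, totalEnergy, hcol, Finset.sum_const, Finset.card_univ,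
        Fintype.card_fin, Fintype.card_perm, nsmul_eq_mul, norm_mul, Complex.norm_natCast]
      ring)
    (by
      simp only [symSum, hz, matrixEnergy, hcol, Finset.sum_const, Finset.card_univ,
        Fintype.card_fin, Fintype.card_perm, nsmul_eq_mul, Complex.norm_natCast]
      ring)
  rw [← hγ, symSum_orbitRep (totalEnergy_neg hn) (by simp)] at h
  have hle : ∀ δ, totalEnergy H δ ≤ (d : ℝ) ^ 4 := by
    intro δ
    have h1 : ‖∑ j, columnSum H δ j‖ ≤ (d : ℝ) ^ 2 := by
      calc ‖∑ j, columnSum H δ j‖ ≤ ∑ j, ∑ k, ‖laurentMonomial (fun r => H j r k) δ‖ :=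
            (norm_sum_le _ _).trans (Finset.sum_le_sum fun j _ => norm_sum_le _ _)
        _ = (d : ℝ) ^ 2 := by
            simp only [fun j k => norm_laurentMonomial (fun r => hn j r k)]
            simp [sq]
    calc totalEnergy H δ ≤ ((d : ℝ) ^ 2) ^ 2 := pow_le_pow_left₀ (norm_nonneg _) h1 2
      _ = (d : ℝ) ^ 4 := by ring
  refine le_antisymm (hle γ) ?_
  -- The certificate bounds only the sum over all d! rearrangements. As no term exceeds d⁴, a
  -- deficit at the identity permutation would already violate it.
  by_contra! hlt
  refine absurd h (not_le.2 ?_)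
  have h2 : symSum (totalEnergy H) (List.ofFn γ) <
      ∑ _σ : Equiv.Perm (Fin d), (d : ℝ) ^ 4 :=
    Finset.sum_lt_sum (fun σ _ => hle _) ⟨1, Finset.mem_univ _, by
      simpa only [Equiv.Perm.coe_one, id, getD_ofFn] using hlt⟩
  simpa [Fintype.card_perm] using h2

/-- If the exponent `p (e_r - e_0)` has maximal energy, then the `r`-th row consists of `p`-th roots
of unity. -/
lemma entry_pow_eq_one {d : ℕ} [NeZero d] {H : Fin d → Matrix (Fin d) (Fin d) ℂ}
    (hH : IsMUHSystem H) (hnorm : IsNormalizedSystem H) {p : ℕ} {r : Fin d}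
    (h : totalEnergy H (fun i => (if i = r then (p : ℤ) else 0) - if i = 0 then (p : ℤ) else 0) =
      (d : ℝ) ^ 4) (j k : Fin d) : H j r k ^ p = 1 := by
  set γ : Fin d → ℤ := fun i => (if i = r then (p : ℤ) else 0) - if i = 0 then (p : ℤ) else 0
  have hn : ∀ j r k, ‖H j r k‖ = 1 := fun j => (hH.hadamard j).norm_entry
  have hmon : ∀ j k, laurentMonomial (fun r => H j r k) γ = H j r k ^ p := by
    intro j k
    have hne : ∀ i, H j i k ≠ 0 := fun i h0 => by simpa [h0] using hn j i k
    simp only [laurentMonomial, γ, fun i => zpow_sub₀ (hne i), Finset.prod_div_distrib]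
    rw [Finset.prod_eq_single r (by simp +contextual) (by simp),
      Finset.prod_eq_single 0 (by simp +contextual) (by simp)]
    simp [hnorm.first_row]
  have h1 : ‖∑ x : Fin d × Fin d, H x.1 r x.2 ^ p‖ = Fintype.card (Fin d × Fin d) := by
    rw [Fintype.sum_prod_type]
    simp only [totalEnergy, columnSum, hmon] at h
    rw [show (d : ℝ) ^ 4 = ((d : ℝ) ^ 2) ^ 2 by ring] at h
    rw [(pow_left_inj₀ (norm_nonneg _) (by positivity) two_ne_zero).1 h]
    simp [sq]
  have h2 := eq_of_norm_sum_eq_card (fun x : Fin d × Fin d => by simp [hn]) h1 (j, k) (0, 0)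
  simpa [hnorm.first_column] using h2

theorem proposition2p2 (d : ℕ) [NeZero d] (H : Fin d → Matrix (Fin d) (Fin d) ℂ)
    (hMUH : IsMUHSystem H) (hnorm : IsNormalizedSystem H) :
    ((d = 3 ∨ d = 4 ∨ d = 5) → ∀ j r k, H j r k ^ d = 1) ∧
      (d = 2 → ∀ j r k, H j r k ^ 4 = 1) := by
  -- Comparing indices with 0 in ℕ keeps the `NeZero` instance out of the orbit condition, so that
  -- it is decidable by evaluation for each concrete d.
  have main : ∀ {p K : ℕ} {t : List ℤ} {c : List ExponentMultiplier},
      ExponentMultiplier.Certifies d t K c →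
      (∀ r : Fin d, (r : ℕ) ≠ 0 → orbitRep (List.ofFn fun i : Fin d =>
        (if i = r then (p : ℤ) else 0) - if (i : ℕ) = 0 then (p : ℤ) else 0) = t) →
      ∀ j r k, H j r k ^ p = 1 := by
    intro p K t c hc ht j r k
    simp only [ne_eq, Fin.val_eq_zero_iff] at ht
    by_cases hr : r = 0
    · simp [hr, hnorm.first_row]
    · exact entry_pow_eq_one hMUH hnorm
        (totalEnergy_eq_of_certifies hMUH (NeZero.ne d) hc (ht r hr)) j k
  refine ⟨?_, ?_⟩
  · rintro (rfl | rfl | rfl)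
    · exact main certifies_order_three (by decide +kernel)
    · exact main certifies_order_four (by decide +kernel)
    · exact main certifies_order_five (by decide +kernel)
  · rintro rfl
    exact main certifies_order_two (by decide +kernel)
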